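/- Conventions. Let $N=\{0,1,2,\dots\}$. A *$0$-bisimple inverse $\omega$-semigroup* is an inverse semigroup $S$ with zero $0$ that has exactly two $\mathscr D$-classes, $S\setminus\{0\}$ and $\{0\}$, and whose set of nonzero idempotents, with the natural partial order ($e\leqslant f$ iff $ef=fe=e$), is order isomorphic to $\{0,-1,-2,\dots\}$. A *maximal subgroup* of $S$ is a subsemigroup that is a group under the operation of $S$ and is not properly contained in another such subsemigroup. For a group $G$ and a homomorphism $\theta\colon G\to G$, let $\mathbf B(G,\theta)^0$ be the set $(N\times G\times N)\sqcup\{0\}$ with $0$ as zero and $$(i,s,j)(m,t,n)=\bigl(i+m-\min\{j,m\},\ \theta^{\,m-\min\{j,m\}}(s)\,\theta^{\,j-\min\{j,m\}}(t),\ j+n-\min\{j,m\}\bigr).$$ If $G$ carries a topology, $\tau^{\oplus}$ denotes the topology on $\mathbf B(G,\theta)^0$ in which $0$ is isolated and in which the sets $\{(i,u,j): u\in U\}$, $U$ an open neighbourhood of $g$ in $G$, form a base at $(i,g,j)$. **Corollary 3.14.** Let $S$ be a $0$-bisimple inverse $\omega$-semigroup with a Hausdorff locally compact topology in which the multiplication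 $S\times S\to S$ is (jointly) continuous, and let $G\neq\{0\}$ be a maximal subgroup of $S$ that is compact in the subspace topology. Then there is a continuous homomorphism $\theta\colon G\to G$ such that $S$ is topologically isomorphic (by a semigroup isomorphism that is a homeomorphism) to $\bigl(\mathbf B(G,\theta)^0,\tau^{\oplus}\bigr)$. In particular, $0$ is an isolated point of $S$, and $S$ is the topological sum of its $\mathscr H$-classes. -/

import Mathlib

/-! Green's relations, `0`-bisimple inverse `ω`-semigroups and their maximal subgroups. -/

/-- Green's relation `L`: `a` and `b` generate the same principal left ideal, `S¹a = S¹b`. -/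
def GreenL {S : Type*} [Semigroup S] (a b : S) : Prop :=
  (a = b ∨ ∃ u, u * b = a) ∧ (b = a ∨ ∃ v, v * a = b)

/-- Green's relation `R`: `a` and `b` generate the same principal right ideal, `aS¹ = bS¹`. -/
def GreenR {S : Type*} [Semigroup S] (a b : S) : Prop :=
  (a = b ∨ ∃ u, b * u = a) ∧ (b = a ∨ ∃ v, a * v = b)

/-- Green's relation `D`, the composition `L ∘ R` (which is also `R ∘ L` and `L ∨ R`). -/
def GreenD {S : Type*} [Semigroup S] (a b : S) : Prop :=
  ∃ c, GreenL a c ∧ GreenR c b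

theorem GreenL.equivalence (S : Type*) [Semigroup S] : Equivalence (GreenL (S := S)) where
  refl _ := ⟨Or.inl rfl, Or.inl rfl⟩
  symm h := ⟨h.2, h.1⟩
  trans := by
    have key : ∀ a b c : S, (a = b ∨ ∃ u, u * b = a) → (b = c ∨ ∃ u, u * c = b) →
        (a = c ∨ ∃ u, u * c = a) := by
      rintro a b c (rfl | ⟨u, rfl⟩) (rfl | ⟨v, rfl⟩)
      · exact Or.inl rfl
      · exact Or.inr ⟨v, rfl⟩
      · exact Or.inr ⟨u, rfl⟩
      · exact Or.inr ⟨u * v, mul_assoc _ _ _⟩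
    intro a b c h k
    exact ⟨key _ _ _ h.1 k.1, key _ _ _ k.2 h.2⟩

theorem GreenR.equivalence (S : Type*) [Semigroup S] : Equivalence (GreenR (S := S)) where
  refl _ := ⟨Or.inl rfl, Or.inl rfl⟩
  symm h := ⟨h.2, h.1⟩
  trans := by
    have key : ∀ a b c : S, (a = b ∨ ∃ u, b * u = a) → (b = c ∨ ∃ u, c * u = b) →
        (a = c ∨ ∃ u, c * u = a) := by
      rintro a b c (rfl | ⟨u, rfl⟩) (rfl | ⟨v, rfl⟩)
      · exact Or.inl rfl
      · exact Or.inr ⟨v, rfl⟩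
      · exact Or.inr ⟨u, rfl⟩
      · exact Or.inr ⟨v * u, (mul_assoc _ _ _).symm⟩
    intro a b c h k
    exact ⟨key _ _ _ h.1 k.1, key _ _ _ k.2 h.2⟩

/-- Green's relation `H = L ∩ R`, as an equivalence relation. -/
def greenH (S : Type*) [Semigroup S] : Setoid S where
  r a b := GreenL a b ∧ GreenR a b
  iseqv :=
    { refl := fun a => ⟨(GreenL.equivalence S).refl a, (GreenR.equivalence S).refl a⟩
      symm := fun h => ⟨(GreenL.equivalence S).symm h.1, (GreenR.equivalence S).symm h.2⟩
      trans := fun h k =>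
        ⟨(GreenL.equivalence S).trans h.1 k.1, (GreenR.equivalence S).trans h.2 k.2⟩ }

/-- The space `S` is the topological sum of its `H`-classes: the canonical bijection from the
disjoint sum of the `H`-classes (each with the subspace topology) to `S` is a homeomorphism. -/
def IsTopologicalSumOfHClasses (S : Type*) [Semigroup S] [TopologicalSpace S] : Prop :=
  IsHomeomorph
    (fun p : (c : Quotient (greenH S)) × {x : S // Quotient.mk (greenH S) x = c} => (p.2 : S))

/-- A `0`-bisimple inverse `ω`-semigroup: an inverse semigroup with zero whose `D`-classes are
exactly `S \ {0}` and `{0}`, and whose nonzero idempotents, with the natural partial order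
`e ≤ f ↔ ef = fe = e`, form a chain isomorphic to `{0, -1, -2, …}`, i.e. to `ℕ` with the
reverse order. -/
structure IsZeroBisimpleInverseOmegaSemigroup (S : Type*) [SemigroupWithZero S] : Prop where
  inverse : ∀ x : S, ∃! y : S, x * y * x = x ∧ y * x * y = y
  greenD_iff : ∀ a b : S, GreenD a b ↔ (a = 0 ↔ b = 0)
  omega : Nonempty
    ((fun e f : {e : S // IsIdempotentElem e ∧ e ≠ 0} =>
        (e : S) * f = e ∧ (f : S) * e = e) ≃r (fun m n : ℕ => n ≤ m))

/-- The subsemigroup `G` of `S` is a group under the operation of `S` (its identity need not be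
an identity of `S`). -/
def IsSubgroupOfSemigroup {S : Type*} [Semigroup S] (G : Subsemigroup S) : Prop :=
  ∃ e ∈ G, (∀ x ∈ G, e * x = x ∧ x * e = x) ∧ ∀ x ∈ G, ∃ y ∈ G, x * y = e ∧ y * x = e

/-- The group structure carried by a subsemigroup that is a group under the operation of `S`. -/
noncomputable abbrev IsSubgroupOfSemigroup.group {S : Type*} [Semigroup S] {G : Subsemigroup S}
    (h : IsSubgroupOfSemigroup G) : Group G :=
  { MulMemClass.toSemigroup G with
    one := ⟨h.choose, h.choose_spec.1⟩
    one_mul := fun x => Subtype.ext (h.choose_spec.2.1 x x.2).1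
    mul_one := fun x => Subtype.ext (h.choose_spec.2.1 x x.2).2
    inv := fun x =>
      ⟨(h.choose_spec.2.2 x x.2).choose, (h.choose_spec.2.2 x x.2).choose_spec.1⟩
    inv_mul_cancel := fun x => Subtype.ext (h.choose_spec.2.2 x x.2).choose_spec.2.2 }

/-- A maximal subgroup of `S`: a subgroup of `S` not properly contained in another one. -/
def IsMaximalSubgroup {S : Type*} [Semigroup S] (G : Subsemigroup S) : Prop :=
  Maximal IsSubgroupOfSemigroup G

/-- The underlying set `ℕ × G × ℕ` of the Bruck–Reilly extension (Reilly semigroup) `B(G, θ)` of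
a group `G` with respect to an endomorphism `θ`. -/
@[ext]
structure Reilly {G : Type*} [Group G] (θ : G →* G) where
  fst : ℕ
  val : G
  snd : ℕ

namespace Reilly

variable {G : Type*} [Group G] {θ : G →* G}

/-- `(i,s,j)(m,t,n) = (i+m-min(j,m), θ^{m-min(j,m)}(s) θ^{j-min(j,m)}(t), j+n-min(j,m))`; all
subtractions are of smaller numbers from larger ones. -/
instance : Mul (Reilly θ) where
  mul a b :=
    { fst := a.fst + b.fst - min a.snd b.fst
      val := θ^[b.fst - min a.snd b.fst] a.val * θ^[a.snd - min a.snd b.fst] b.val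
      snd := a.snd + b.snd - min a.snd b.fst }

theorem mul_def (a b : Reilly θ) : a * b =
    ⟨a.fst + b.fst - min a.snd b.fst,
      θ^[b.fst - min a.snd b.fst] a.val * θ^[a.snd - min a.snd b.fst] b.val,
      a.snd + b.snd - min a.snd b.fst⟩ := rfl

instance : Semigroup (Reilly θ) where
  mul_assoc := by
    rintro ⟨i, s, j⟩ ⟨m, t, n⟩ ⟨k, u, l⟩
    simp only [mul_def, Reilly.mk.injEq, iterate_map_mul, ← Function.iterate_add_apply, mul_assoc]
    refine ⟨by omega, ?_, by omega⟩
    have e₁ : k - min (n + j - min j m) k + (m - min j m)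
        = m + k - min n k - min j (m + k - min n k) := by omega
    have e₂ : k - min (n + j - min j m) k + (j - min j m)
        = j - min j (m + k - min n k) + (k - min n k) := by omega
    have e₃ : n + j - min j m - min (n + j - min j m) k
        = j - min j (m + k - min n k) + (n - min n k) := by omega
    rw [add_comm j n, e₁, e₂, e₃]

end Reilly

/-- The Reilly semigroup `B(G, θ)⁰` with adjoined zero. -/
def ReillyZero {G : Type*} [Group G] (θ : G →* G) : Type _ := WithZero (Reilly θ)

namespace ReillyZero

variable {G : Type*} [Group G] {θ : G →* G}

instance : SemigroupWithZero (ReillyZero θ) :=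
  inferInstanceAs (SemigroupWithZero (WithZero (Reilly θ)))

/-- The nonzero element `(i, g, j)` of `B(G, θ)⁰`. -/
def of (θ : G →* G) (i : ℕ) (g : G) (j : ℕ) : ReillyZero θ :=
  ((⟨i, g, j⟩ : Reilly θ) : WithZero (Reilly θ))

/-- The topology `τ^⊕` on `B(G, θ)⁰`: a base at `(i, g, j)` is formed by the sets
`U_{i,j} = {(i, u, j) : u ∈ U}` with `U` a neighbourhood of `g` in a base of `G`, and zero is an
isolated point. Equivalently, a set is open iff its trace on each `G_{i,j}` is open in
`G_{i,j} ≅ G`, without condition at zero. -/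
instance [TopologicalSpace G] : TopologicalSpace (ReillyZero θ) where
  IsOpen V := ∀ i j : ℕ, IsOpen {g : G | of θ i g j ∈ V}
  isOpen_univ _ _ := isOpen_univ
  isOpen_inter _ _ hV hW i j := (hV i j).inter (hW i j)
  isOpen_sUnion F hF i j := by
    have : {g : G | of θ i g j ∈ ⋃₀ F} = ⋃ V ∈ F, {g : G | of θ i g j ∈ V} := by
      ext g; simp
    rw [this]
    exact isOpen_biUnion fun V hV => hF V hV i j

end ReillyZero

/-! Algebra: the largest idempotent is an identity, and bisimplicity gives `p * q = 1` with `q * p`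
the next idempotent of the chain. Units commute with idempotents, so `u ↦ p * u * q` is an
endomorphism `θ` of the group of units, and every nonzero element is uniquely `q ^ i * u * p ^ j`
(`exists_isReillyFrame`, `ext_iff`); `mul_eq` is then the Reilly product. The identity of `G` is
𝒟-related to `1`, which makes `G` a copy of the group of units, and the latter is compact.

Topology: for fixed `i`, `j` these elements form a cell, a continuous image of the group of units,
hence compact. Being moved by an idempotent is an open condition that cuts out finite unions of
cells, so cells are open (`isOpen_cell`).

Zero is isolated (`isOpen_singleton_zero`): let `K` be a compact neighbourhood of `0` and `V` a
smaller open one that `p` and `q` multiply into `K` on either side. Then `K \ V` meets finitely many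
cells, so far out `K` is stable under unit moves between cells. If `K` met a far cell, a walk would
reach the cells `(n, 0)` and `(0, n)` inside `V`; but a product of such elements can be a unit,
against continuity of multiplication at `(0, 0)`. So `K \ {0}` lies in a finite union of cells,
which is closed and misses `0`. -/

section Frame

/-- A factorisation of the nonzero elements of a monoid with zero as `q ^ i * u * p ^ j` with `u` a
unit, where `p * q = 1` and `p`, `q` commute with the units up to an endomorphism `θ`. -/
structure IsReillyFrame {M : Type*} [MonoidWithZero M] (p q : M) (θ : Mˣ →* Mˣ) : Prop where
  one_ne_zero : (1 : M) ≠ 0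
  mul_eq_one : p * q = 1
  mul_ne_one : q * p ≠ 1
  mul_unit : ∀ u : Mˣ, p * u = θ u * p
  unit_mul : ∀ u : Mˣ, u * q = q * θ u
  exists_eq : ∀ x : M, x ≠ 0 → ∃ (i : ℕ) (u : Mˣ) (j : ℕ), x = q ^ i * u * p ^ j

/-! ### Normal forms and cells. -/

namespace IsReillyFrame

variable {M : Type*} [MonoidWithZero M] {p q : M} {θ : Mˣ →* Mˣ}

theorem pow_mul_pow (h : IsReillyFrame p q θ) (n : ℕ) : p ^ n * q ^ n = 1 := by
  induction n with
  | zero => simp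
  | succ n ih =>
    calc p ^ (n + 1) * q ^ (n + 1) = p ^ n * (p * q) * q ^ n := by
          rw [pow_succ, pow_succ']; simp only [mul_assoc]
      _ = 1 := by rw [h.mul_eq_one, mul_one, ih]

theorem pow_mul_pow_add (h : IsReillyFrame p q θ) (n k : ℕ) : p ^ n * q ^ (n + k) = q ^ k := by
  rw [pow_add, ← mul_assoc, h.pow_mul_pow, one_mul]

theorem pow_add_mul_pow (h : IsReillyFrame p q θ) (n k : ℕ) : p ^ (n + k) * q ^ n = p ^ k := by
  rw [add_comm, pow_add, mul_assoc, h.pow_mul_pow, mul_one]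

theorem pow_mul_unit (h : IsReillyFrame p q θ) (n : ℕ) (u : Mˣ) :
    p ^ n * u = (θ^[n] u : Mˣ) * p ^ n := by
  induction n generalizing u with
  | zero => simp
  | succ n ih =>
    rw [pow_succ, mul_assoc, h.mul_unit, ← mul_assoc, ih, mul_assoc, Function.iterate_succ_apply]

theorem unit_mul_pow (h : IsReillyFrame p q θ) (n : ℕ) (u : Mˣ) :
    u * q ^ n = q ^ n * (θ^[n] u : Mˣ) := by
  induction n generalizing u with
  | zero => simp
  | succ n ih =>
    rw [pow_succ', ← mul_assoc, h.unit_mul, mul_assoc, ih, mul_assoc, Function.iterate_succ_apply]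

/-- The inner `p ^ j * q ^ m` collapses to a power of `q` or of `p`, which is then pushed outwards
past a unit at the cost of iterating `θ`. -/
theorem mul_eq (h : IsReillyFrame p q θ) (i j m n : ℕ) (s t : Mˣ) :
    q ^ i * s * p ^ j * (q ^ m * t * p ^ n) =
      q ^ (i + m - min j m) * (θ^[m - min j m] s * θ^[j - min j m] t : Mˣ) *
        p ^ (j + n - min j m) := by
  rcases le_total j m with hjm | hjm
  · obtain ⟨k, rfl⟩ := Nat.exists_eq_add_of_le hjm
    have e₁ : i + (j + k) - min j (j + k) = i + k := by omega
    have e₂ : j + k - min j (j + k) = k := by omega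
    have e₃ : j - min j (j + k) = 0 := by omega
    have e₄ : j + n - min j (j + k) = n := by omega
    rw [e₁, e₂, e₃, e₄]
    calc q ^ i * s * p ^ j * (q ^ (j + k) * t * p ^ n)
        = q ^ i * (s * (p ^ j * q ^ (j + k))) * t * p ^ n := by simp only [mul_assoc]
      _ = _ := by
          rw [h.pow_mul_pow_add, h.unit_mul_pow, pow_add]
          simp only [mul_assoc, Units.val_mul, Function.iterate_zero, id]
  · obtain ⟨k, rfl⟩ := Nat.exists_eq_add_of_le hjm
    have e₁ : i + m - min (m + k) m = i := by omega
    have e₂ : m - min (m + k) m = 0 := by omega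
    have e₃ : m + k - min (m + k) m = k := by omega
    have e₄ : m + k + n - min (m + k) m = k + n := by omega
    rw [e₁, e₂, e₃, e₄]
    calc q ^ i * s * p ^ (m + k) * (q ^ m * t * p ^ n)
        = q ^ i * s * (p ^ (m + k) * q ^ m * t) * p ^ n := by simp only [mul_assoc]
      _ = _ := by
          rw [h.pow_add_mul_pow, h.pow_mul_unit, pow_add]
          simp only [mul_assoc, Units.val_mul, Function.iterate_zero, id]

theorem ne_zero (h : IsReillyFrame p q θ) (i j : ℕ) (u : Mˣ) : q ^ i * u * p ^ j ≠ 0 := by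
  intro h0
  apply h.one_ne_zero
  calc (1 : M) = p ^ i * q ^ i * (u * (p ^ j * q ^ j)) * (u⁻¹ : Mˣ) := by simp [h.pow_mul_pow]
    _ = p ^ i * (q ^ i * u * p ^ j) * q ^ j * (u⁻¹ : Mˣ) := by simp only [mul_assoc]
    _ = 0 := by simp [h0]

theorem right_mul_ne_one (h : IsReillyFrame p q θ) (z : M) : q * z ≠ 1 := by
  intro hz
  have : p = z := by rw [← one_mul z, ← h.mul_eq_one, mul_assoc, hz, mul_one]
  exact h.mul_ne_one (this ▸ hz)

theorem mul_left_ne_one (h : IsReillyFrame p q θ) (z : M) : z * p ≠ 1 := by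
  intro hz
  have : z = q := by rw [← mul_one z, ← h.mul_eq_one, ← mul_assoc, hz, one_mul]
  exact h.mul_ne_one (this ▸ hz)

/-- If `i < k`, cancelling `q ^ i`, `p ^ j` and `u` would leave a right inverse of `q`. -/
theorem fst_le_of_eq (h : IsReillyFrame p q θ) {i j k l : ℕ} {u v : Mˣ}
    (he : q ^ i * u * p ^ j = q ^ k * v * p ^ l) : k ≤ i := by
  by_contra! hik
  obtain ⟨d, rfl⟩ := Nat.exists_eq_add_of_lt hik
  apply h.right_mul_ne_one (q ^ d * v * p ^ l * q ^ j * (u⁻¹ : Mˣ))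
  calc q * (q ^ d * v * p ^ l * q ^ j * (u⁻¹ : Mˣ))
      = q ^ (d + 1) * (v * p ^ l * q ^ j * (u⁻¹ : Mˣ)) := by rw [pow_succ']; simp only [mul_assoc]
    _ = p ^ i * (q ^ (i + d + 1) * v * p ^ l) * q ^ j * (u⁻¹ : Mˣ) := by
        rw [← h.pow_mul_pow_add i]; simp only [mul_assoc, add_assoc]
    _ = p ^ i * q ^ i * u * (p ^ j * q ^ j) * (u⁻¹ : Mˣ) := by rw [← he]; simp only [mul_assoc]
    _ = 1 := by simp [h.pow_mul_pow]

theorem snd_le_of_eq (h : IsReillyFrame p q θ) {i j k l : ℕ} {u v : Mˣ}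
    (he : q ^ i * u * p ^ j = q ^ k * v * p ^ l) : l ≤ j := by
  by_contra! hik
  obtain ⟨d, rfl⟩ := Nat.exists_eq_add_of_lt hik
  apply h.mul_left_ne_one ((u⁻¹ : Mˣ) * p ^ i * q ^ k * v * p ^ d)
  calc (u⁻¹ : Mˣ) * p ^ i * q ^ k * v * p ^ d * p
      = (u⁻¹ : Mˣ) * p ^ i * q ^ k * v * p ^ (d + 1) := by rw [pow_succ]; simp only [mul_assoc]
    _ = (u⁻¹ : Mˣ) * p ^ i * (q ^ k * v * p ^ (j + d + 1)) * q ^ j := by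
        simp only [mul_assoc, add_assoc, h.pow_add_mul_pow]
    _ = (u⁻¹ : Mˣ) * (p ^ i * q ^ i) * u * (p ^ j * q ^ j) := by rw [← he]; simp only [mul_assoc]
    _ = 1 := by simp [h.pow_mul_pow]

theorem ext_iff (h : IsReillyFrame p q θ) {i j k l : ℕ} {u v : Mˣ} :
    q ^ i * u * p ^ j = q ^ k * v * p ^ l ↔ i = k ∧ u = v ∧ j = l := by
  refine ⟨fun he => ?_, fun he => by rw [he.1, he.2.1, he.2.2]⟩
  obtain rfl := le_antisymm (h.fst_le_of_eq he.symm) (h.fst_le_of_eq he)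
  obtain rfl := le_antisymm (h.snd_le_of_eq he.symm) (h.snd_le_of_eq he)
  refine ⟨rfl, Units.ext ?_, rfl⟩
  have key : ∀ w : Mˣ, p ^ i * (q ^ i * w * p ^ j) * q ^ j = w := fun w => by
    rw [← mul_assoc, ← mul_assoc, h.pow_mul_pow, one_mul, mul_assoc, h.pow_mul_pow, mul_one]
  rw [← key u, he, key v]

/-- The set of elements `q ^ i * u * p ^ j` with `u` a unit. -/
def cell (p q : M) (i j : ℕ) : Set M := Set.range fun u : Mˣ => q ^ i * (u : M) * p ^ j

theorem exists_mem_cell (h : IsReillyFrame p q θ) {x : M} (hx : x ≠ 0) :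
    ∃ i j, x ∈ cell p q i j := by
  obtain ⟨i, u, j, rfl⟩ := h.exists_eq x hx
  exact ⟨i, j, u, rfl⟩

theorem zero_notMem_cell (h : IsReillyFrame p q θ) (i j : ℕ) : (0 : M) ∉ cell p q i j := by
  rintro ⟨u, hu⟩
  exact h.ne_zero i j u hu

theorem eq_of_mem_cell (h : IsReillyFrame p q θ) {i j k l : ℕ} {x : M} (hx : x ∈ cell p q i j)
    (hx' : x ∈ cell p q k l) : i = k ∧ j = l := by
  obtain ⟨u, rfl⟩ := hx
  obtain ⟨v, hv⟩ := hx'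
  obtain ⟨hi, -, hj⟩ := h.ext_iff.1 hv
  exact ⟨hi.symm, hj.symm⟩

theorem left_mul_mem_cell (h : IsReillyFrame p q θ) {i j : ℕ} {x : M}
    (hx : x ∈ cell p q (i + 1) j) : p * x ∈ cell p q i j := by
  obtain ⟨u, rfl⟩ := hx
  refine ⟨u, ?_⟩
  simp only [pow_succ', ← mul_assoc, h.mul_eq_one, one_mul]

theorem mul_right_mem_cell (h : IsReillyFrame p q θ) {i j : ℕ} {x : M}
    (hx : x ∈ cell p q i (j + 1)) : x * q ∈ cell p q i j := by
  obtain ⟨u, rfl⟩ := hx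
  refine ⟨u, ?_⟩
  simp only [pow_succ, mul_assoc, h.mul_eq_one, mul_one]

theorem left_mul_mem_cell_succ {i j : ℕ} {x : M} (hx : x ∈ cell p q i j) :
    q * x ∈ cell p q (i + 1) j := by
  obtain ⟨u, rfl⟩ := hx
  exact ⟨u, by simp only [pow_succ', mul_assoc]⟩

theorem mul_right_mem_cell_succ {i j : ℕ} {x : M} (hx : x ∈ cell p q i j) :
    x * p ∈ cell p q i (j + 1) := by
  obtain ⟨u, rfl⟩ := hx
  exact ⟨u, by simp only [pow_succ, mul_assoc]⟩

theorem mul_mem_cell_zero (h : IsReillyFrame p q θ) {n : ℕ} {x y : M} (hx : x ∈ cell p q 0 n)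
    (hy : y ∈ cell p q n 0) : x * y ∈ cell p q 0 0 := by
  obtain ⟨u, rfl⟩ := hx
  obtain ⟨v, rfl⟩ := hy
  refine ⟨u * v, ?_⟩
  have : (u : M) * p ^ n * (q ^ n * v) = u * (p ^ n * q ^ n) * v := by simp only [mul_assoc]
  simp [this, h.pow_mul_pow]

theorem greenH_of_mem_cell (h : IsReillyFrame p q θ) {i j : ℕ} {x y : M} (hx : x ∈ cell p q i j)
    (hy : y ∈ cell p q i j) : greenH M x y := by
  obtain ⟨u, rfl⟩ := hx
  obtain ⟨v, rfl⟩ := hy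
  have hL : ∀ s t : Mˣ, q ^ i * s * (t⁻¹ : Mˣ) * p ^ i * (q ^ i * t * p ^ j) =
      q ^ i * s * p ^ j := fun s t =>
    calc _ = q ^ i * s * (t⁻¹ : Mˣ) * (p ^ i * q ^ i) * t * p ^ j := by simp only [mul_assoc]
      _ = q ^ i * s * ((t⁻¹ : Mˣ) * t) * p ^ j := by
          rw [h.pow_mul_pow, mul_one]; simp only [mul_assoc]
      _ = _ := by rw [Units.inv_mul, mul_one]
  have hR : ∀ s t : Mˣ, q ^ i * t * p ^ j * (q ^ j * (t⁻¹ : Mˣ) * s * p ^ j) =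
      q ^ i * s * p ^ j := fun s t =>
    calc _ = q ^ i * t * (p ^ j * q ^ j) * (t⁻¹ : Mˣ) * s * p ^ j := by simp only [mul_assoc]
      _ = q ^ i * (t * (t⁻¹ : Mˣ)) * s * p ^ j := by
          rw [h.pow_mul_pow, mul_one]; simp only [mul_assoc]
      _ = _ := by rw [Units.mul_inv, mul_one]
  exact ⟨⟨.inr ⟨_, hL u v⟩, .inr ⟨_, hL v u⟩⟩, ⟨.inr ⟨_, hR u v⟩, .inr ⟨_, hR v u⟩⟩⟩

/-- The elements whose two indices are at most `i` and `j` are those moved by the idempotents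
`q ^ (i + 1) * p ^ (i + 1)` on the left and `q ^ (j + 1) * p ^ (j + 1)` on the right. -/
theorem moved_iff (h : IsReillyFrame p q θ) (i j : ℕ) (x : M) :
    (q ^ (i + 1) * p ^ (i + 1) * x ≠ x ∧ x * (q ^ (j + 1) * p ^ (j + 1)) ≠ x) ↔
      ∃ k ≤ i, ∃ l ≤ j, x ∈ cell p q k l := by
  by_cases hx : x = 0
  · subst hx
    simp [h.zero_notMem_cell]
  obtain ⟨k, u, l, rfl⟩ := h.exists_eq x hx
  -- The idempotent with exponent `i + 1` fixes exactly the normal forms with first index above `i`.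
  have hl : q ^ (i + 1) * p ^ (i + 1) * (q ^ k * u * p ^ l) = q ^ k * u * p ^ l ↔ i < k := by
    have e := h.mul_eq (i + 1) (i + 1) k l 1 u
    simp only [Units.val_one, mul_one] at e
    rw [e]
    refine ⟨fun he => ?_, fun hik => ?_⟩
    · have := (h.ext_iff.1 he).1
      omega
    · rw [h.ext_iff]
      have : i + 1 - min (i + 1) k = 0 := by omega
      refine ⟨by omega, ?_, by omega⟩
      rw [this, iterate_map_one, one_mul, Function.iterate_zero, id]
  have hr : q ^ k * u * p ^ l * (q ^ (j + 1) * p ^ (j + 1)) = q ^ k * u * p ^ l ↔ j < l := by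
    have e := h.mul_eq k l (j + 1) (j + 1) u 1
    simp only [Units.val_one, mul_one] at e
    rw [e]
    refine ⟨fun he => ?_, fun hik => ?_⟩
    · have := (h.ext_iff.1 he).2.2
      omega
    · rw [← mul_one u, h.ext_iff]
      have : j + 1 - min l (j + 1) = 0 := by omega
      refine ⟨by omega, ?_, by omega⟩
      simp [this]
  rw [Ne, Ne, hl, hr]
  refine ⟨fun hkl => ⟨k, by omega, l, by omega, u, rfl⟩, ?_⟩
  rintro ⟨k', hk, l', hl', hm⟩
  obtain ⟨rfl, rfl⟩ := h.eq_of_mem_cell ⟨u, rfl⟩ hm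
  omega

/-! ### Cells are compact and open. -/

section Topology

variable [TopologicalSpace M] [ContinuousMul M]

theorem isCompact_cell (hc : IsCompact (cell p q 0 0)) (i j : ℕ) : IsCompact (cell p q i j) := by
  have : cell p q i j = (fun x => q ^ i * x * p ^ j) '' cell p q 0 0 := by
    rw [cell, cell, ← Set.range_comp]
    simp [Function.comp_def]
  rw [this]
  exact hc.image (by fun_prop)

variable [T2Space M]

/-- By `moved_iff` the cells with indices at most `(i, j)` have open union; removing all but one of
them removes a finite union of compact, hence closed, sets. -/
theorem isOpen_cell (h : IsReillyFrame p q θ) (hc : IsCompact (cell p q 0 0)) (i j : ℕ) :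
    IsOpen (cell p q i j) := by
  have e : cell p q i j =
      ({x | q ^ (i + 1) * p ^ (i + 1) * x ≠ x} ∩ {x | x * (q ^ (j + 1) * p ^ (j + 1)) ≠ x}) \
        ⋃ k ∈ ((Finset.range (i + 1) ×ˢ Finset.range (j + 1)).erase (i, j) : Finset (ℕ × ℕ)),
          cell p q k.1 k.2 := by
    ext x
    have hm := h.moved_iff i j x
    simp only [Set.mem_sdiff, Set.mem_inter_iff, Set.mem_ofPred_eq, hm, Set.mem_iUnion, not_exists,
      Finset.mem_erase, Finset.mem_product, Finset.mem_range]
    constructor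
    · intro hx
      refine ⟨⟨i, le_rfl, j, le_rfl, hx⟩, fun k hk hxk => hk.1 ?_⟩
      obtain ⟨hi, hj⟩ := h.eq_of_mem_cell hx hxk
      exact Prod.ext hi.symm hj.symm
    · rintro ⟨⟨k, hk, l, hl, hx⟩, hn⟩
      by_cases hkl : (k, l) = (i, j)
      · cases hkl
        exact hx
      · exact absurd hx (hn (k, l) ⟨hkl, by dsimp only; omega, by dsimp only; omega⟩)
  rw [e]
  refine IsOpen.sdiff (IsOpen.inter ?_ ?_) ?_
  · exact isOpen_ne_fun (by fun_prop) continuous_id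
  · exact isOpen_ne_fun (by fun_prop) continuous_id
  · exact (Finset.isCompact_biUnion _ fun k _ => isCompact_cell hc k.1 k.2).isClosed

theorem exists_bound_of_isCompact (h : IsReillyFrame p q θ) (hc : IsCompact (cell p q 0 0))
    {K : Set M} (hK : IsCompact K) (h0 : (0 : M) ∉ K) :
    ∃ n, ∀ i j, ∀ x ∈ K, x ∈ cell p q i j → i < n ∧ j < n := by
  obtain ⟨n, hn⟩ := hK.elim_directed_cover
    (fun n : ℕ => ⋃ i ∈ Set.Iio n, ⋃ j ∈ Set.Iio n, cell p q i j)
    (fun n => isOpen_biUnion fun i _ => isOpen_biUnion fun j _ => h.isOpen_cell hc i j)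
    (fun x hx => by
      obtain ⟨i, j, hij⟩ := h.exists_mem_cell (x := x) (fun h' => h0 (h' ▸ hx))
      simp only [Set.mem_iUnion, Set.mem_Iio]
      exact ⟨i + j + 1, i, by omega, j, by omega, hij⟩)
    (Monotone.directed_le fun m n hmn x hx => by
      simp only [Set.mem_iUnion, Set.mem_Iio] at hx ⊢
      obtain ⟨i, hi, j, hj, hx⟩ := hx
      exact ⟨i, hi.trans_le hmn, j, hj.trans_le hmn, hx⟩)
  refine ⟨n, fun i j x hx hij => ?_⟩
  have := hn hx
  simp only [Set.mem_iUnion, Set.mem_Iio] at this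
  obtain ⟨k, hk, l, hl, hkl⟩ := this
  obtain ⟨rfl, rfl⟩ := h.eq_of_mem_cell hij hkl
  exact ⟨hk, hl⟩

end Topology

end IsReillyFrame

/-- A set of points of the grid that is closed under the unit moves starting outside the square
`[0, n)²` and meets the complement of that square contains `(n, 0)` and `(0, n)`. -/
theorem grid_corners_of_moves {P : ℕ → ℕ → Prop} {n : ℕ}
    (up : ∀ i j, n ≤ i ∨ n ≤ j → P i j → P (i + 1) j ∧ P i (j + 1))
    (left : ∀ i j, n ≤ i + 1 ∨ n ≤ j → P (i + 1) j → P i j)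
    (down : ∀ i j, n ≤ i ∨ n ≤ j + 1 → P i (j + 1) → P i j)
    {i j : ℕ} (hij : n ≤ i ∨ n ≤ j) (hP : P i j) : P n 0 ∧ P 0 n := by
  have upl : ∀ k, P (i + k) j := by
    intro k
    induction k with
    | zero => exact hP
    | succ k ih => exact (up _ _ (by omega) ih).1
  -- The walk first climbs until both coordinates are at least `n`; it can then follow a far column
  -- or row to an axis, and the axis back to distance `n`, always starting moves outside the square.
  have upr : ∀ k, P (i + n) (j + k) := by
    intro k
    induction k with
    | zero => exact upl n
    | succ k ih => exact (up _ _ (by omega) ih).2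
  have goleft : ∀ l, n ≤ l → ∀ k a, P (a + k) l → P a l := by
    intro l hl k
    induction k with
    | zero => exact fun a ha => ha
    | succ k ih => exact fun a ha => ih a (left _ _ (.inr hl) ha)
  have godown : ∀ l, n ≤ l → ∀ k a, P l (a + k) → P l a := by
    intro l hl k
    induction k with
    | zero => exact fun a ha => ha
    | succ k ih => exact fun a ha => ih a (down _ _ (.inl hl) ha)
  have h := upr n
  constructor
  · have h₁ : P (i + n) 0 := godown _ (by omega) (j + n) 0 (by rwa [zero_add])
    have aux : ∀ k, P (n + k) 0 → P n 0 := by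
      intro k
      induction k with
      | zero => exact id
      | succ k ih => exact fun hk => ih (left _ _ (by omega) hk)
    exact aux i (by rwa [add_comm])
  · have h₁ : P 0 (j + n) := goleft _ (by omega) (i + n) 0 (by rwa [zero_add])
    have aux : ∀ k, P 0 (n + k) → P 0 n := by
      intro k
      induction k with
      | zero => exact id
      | succ k ih => exact fun hk => ih (down _ _ (by omega) hk)
    exact aux j (by rwa [add_comm])

/-! ### Isolation of zero and the topological sum. -/

namespace IsReillyFrame

variable {M : Type*} [MonoidWithZero M] {p q : M} {θ : Mˣ →* Mˣ}

open Topology in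
theorem isOpen_singleton_zero [TopologicalSpace M] [T2Space M] [LocallyCompactSpace M]
    [ContinuousMul M] (h : IsReillyFrame p q θ) (hc : IsCompact (cell p q 0 0)) :
    IsOpen ({0} : Set M) := by
  obtain ⟨K, hK, hK0⟩ := exists_compact_mem_nhds (0 : M)
  have hmul : Filter.Tendsto (fun z : M × M => z.1 * z.2) (𝓝 0 ×ˢ 𝓝 0) (𝓝 0) := by
    rw [← nhds_prod_eq]
    simpa using (continuous_mul (M := M)).tendsto (0, 0)
  have hcl : (cell p q 0 0)ᶜ ∈ 𝓝 (0 : M) :=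
    hc.isClosed.isOpen_compl.mem_nhds (h.zero_notMem_cell 0 0)
  obtain ⟨W, hW, hWW⟩ := Filter.mem_prod_same_iff.1 (hmul hcl)
  have hpre : ∀ f : M → M, Continuous f → f 0 = 0 → f ⁻¹' K ∈ 𝓝 (0 : M) := fun f hf h0 =>
    hf.continuousAt.preimage_mem_nhds (by rwa [h0])
  have hV : W ∩ ((fun x => p * x) ⁻¹' K ∩ (fun x => x * p) ⁻¹' K) ∩
      ((fun x => q * x) ⁻¹' K ∩ (fun x => x * q) ⁻¹' K) ∈ 𝓝 (0 : M) :=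
    Filter.inter_mem (Filter.inter_mem hW (Filter.inter_mem
      (hpre _ (by fun_prop) (by simp)) (hpre _ (by fun_prop) (by simp))))
      (Filter.inter_mem (hpre _ (by fun_prop) (by simp)) (hpre _ (by fun_prop) (by simp)))
  obtain ⟨V, hVsub, hVo, hV0⟩ := mem_nhds_iff.1 hV
  -- Outside the square `[0, n)²`, the trace of `K` on a cell lies in `V`.
  obtain ⟨n, hn⟩ := h.exists_bound_of_isCompact hc (hK.diff hVo) (fun h' => h'.2 hV0)
  have mem_of_le : ∀ i j x, n ≤ i ∨ n ≤ j → x ∈ K → x ∈ cell p q i j → x ∈ V := by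
    intro i j x hij hx hxc
    by_contra hxV
    have := hn i j x ⟨hx, hxV⟩ hxc
    omega
  have hbounded : ∀ i j, (K ∩ cell p q i j).Nonempty → i < n ∧ j < n := by
    intro i j hij
    by_contra hcon
    obtain ⟨⟨x, hxK, hx⟩, y, hyK, hy⟩ :=
      grid_corners_of_moves (P := fun i j => (K ∩ cell p q i j).Nonempty) (n := n)
        (fun i j hij ⟨x, hx, hxc⟩ =>
          have hv := hVsub (mem_of_le i j x hij hx hxc)
          ⟨⟨q * x, hv.2.1, left_mul_mem_cell_succ hxc⟩,
            ⟨x * p, hv.1.2.2, mul_right_mem_cell_succ hxc⟩⟩)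
        (fun i j hij ⟨x, hx, hxc⟩ =>
          ⟨p * x, (hVsub (mem_of_le _ _ x hij hx hxc)).1.2.1, h.left_mul_mem_cell hxc⟩)
        (fun i j hij ⟨x, hx, hxc⟩ =>
          ⟨x * q, (hVsub (mem_of_le _ _ x hij hx hxc)).2.2, h.mul_right_mem_cell hxc⟩)
        (by omega) hij
    -- Both corner elements lie in `W`, yet `y * x` is a unit, while `W * W` avoids the units.
    exact hWW (Set.mk_mem_prod
      (hVsub (mem_of_le _ _ y (.inr le_rfl) hyK hy)).1.1
      (hVsub (mem_of_le _ _ x (.inl le_rfl) hxK hx)).1.1) (h.mul_mem_cell_zero hy hx)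
  have hF : IsClosed (⋃ k ∈ Finset.range n ×ˢ Finset.range n, cell p q k.1 k.2) :=
    (Finset.isCompact_biUnion _ fun k _ => isCompact_cell hc k.1 k.2).isClosed
  have hF0 : (⋃ k ∈ Finset.range n ×ˢ Finset.range n, cell p q k.1 k.2)ᶜ ∈ 𝓝 (0 : M) :=
    hF.isOpen_compl.mem_nhds (by simp [h.zero_notMem_cell])
  rw [isOpen_singleton_iff_nhds_eq_pure]
  refine le_antisymm (Filter.le_pure_iff.2 (Filter.mem_of_superset
    (Filter.inter_mem hK0 hF0) fun x hx => ?_)) (pure_le_nhds 0)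
  by_contra hx0
  obtain ⟨i, j, hij⟩ := h.exists_mem_cell hx0
  obtain ⟨hi, hj⟩ := hbounded i j ⟨x, hx.1, hij⟩
  exact hx.2 (Set.mem_biUnion (x := (i, j)) (by simp [hi, hj]) hij)

/-- It suffices that each cell lies in a single ℋ-class: every class is then a neighbourhood of its
points. -/
theorem isTopologicalSumOfHClasses [TopologicalSpace M] [T2Space M] [LocallyCompactSpace M]
    [ContinuousMul M] (h : IsReillyFrame p q θ) (hc : IsCompact (cell p q 0 0)) :
    IsTopologicalSumOfHClasses M := by
  have hopen : ∀ c : Quotient (greenH M), IsOpen {x : M | Quotient.mk (greenH M) x = c} := by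
    intro c
    rw [isOpen_iff_mem_nhds]
    rintro x rfl
    by_cases hx : x = 0
    · subst hx
      exact Filter.mem_of_superset ((h.isOpen_singleton_zero hc).mem_nhds rfl)
        (by rintro _ rfl; rfl)
    · obtain ⟨i, j, hij⟩ := h.exists_mem_cell hx
      exact Filter.mem_of_superset ((h.isOpen_cell hc i j).mem_nhds hij)
        fun y hy => Quotient.sound (h.greenH_of_mem_cell hy hij)
  refine ⟨?_, ?_, ?_⟩
  · exact continuous_sigma fun c => continuous_subtype_val
  · exact isOpenMap_sigma.2 fun c => (hopen c).isOpenMap_subtype_val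
  · constructor
    · rintro ⟨c, x, rfl⟩ ⟨d, y, rfl⟩ hxy
      obtain rfl : x = y := hxy
      rfl
    · exact fun x => ⟨⟨_, x, rfl⟩, rfl⟩

end IsReillyFrame

end Frame

/-! ### Existence of the factorisation. -/

section Existence

/-- The nonzero idempotents of a `0`-bisimple inverse `ω`-semigroup form a chain
`E 0 > E 1 > ⋯`. -/
structure IsIdempotentChain {S : Type*} [SemigroupWithZero S] (E : ℕ → S) : Prop where
  ne_zero : ∀ n, E n ≠ 0
  mul_eq : ∀ m n, E m * E n = E (max m n)
  injective : Function.Injective E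
  exists_eq : ∀ e : S, IsIdempotentElem e → e ≠ 0 → ∃ n, E n = e

theorem IsZeroBisimpleInverseOmegaSemigroup.exists_isIdempotentChain {S : Type*}
    [SemigroupWithZero S] (hS : IsZeroBisimpleInverseOmegaSemigroup S) :
    ∃ E : ℕ → S, IsIdempotentChain E := by
  obtain ⟨φ⟩ := hS.omega
  have key : ∀ m n, n ≤ m → (φ.symm m : S) * φ.symm n = φ.symm m ∧
      (φ.symm n : S) * φ.symm m = φ.symm m := fun m n hmn => φ.symm.map_rel_iff.2 hmn
  refine ⟨fun n => φ.symm n, fun n => (φ.symm n).2.2, fun m n => ?_,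
    fun m n hmn => φ.symm.injective (Subtype.ext hmn), fun e he he0 =>
      ⟨φ ⟨e, he, he0⟩, by simp⟩⟩
  rcases le_total m n with hmn | hmn
  · rw [max_eq_right hmn, (key n m hmn).2]
  · rw [max_eq_left hmn, (key m n hmn).1]

theorem IsIdempotentChain.isIdempotentElem {S : Type*} [SemigroupWithZero S] {E : ℕ → S}
    (hE : IsIdempotentChain E) (n : ℕ) : IsIdempotentElem (E n) := by
  rw [IsIdempotentElem, hE.mul_eq, max_self]

theorem IsIdempotentChain.zero_mul_and_mul_zero {S : Type*} [SemigroupWithZero S] {E : ℕ → S}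
    (hE : IsIdempotentChain E) (hS : IsZeroBisimpleInverseOmegaSemigroup S) (x : S) :
    E 0 * x = x ∧ x * E 0 = x := by
  by_cases hx : x = 0
  · simp [hx]
  obtain ⟨y, ⟨hxy, hyx⟩, -⟩ := hS.inverse x
  obtain ⟨m, hm⟩ := hE.exists_eq (x * y) (by rw [IsIdempotentElem, ← mul_assoc, hxy])
    (fun h0 => hx (by rw [← hxy, h0, zero_mul]))
  obtain ⟨n, hn⟩ := hE.exists_eq (y * x) (by rw [IsIdempotentElem, ← mul_assoc, hyx])
    (fun h0 => hx (by rw [← hxy, mul_assoc, h0, mul_zero]))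
  constructor
  · rw [← hxy, ← mul_assoc, ← hm, hE.mul_eq, Nat.zero_max]
  · nth_rw 1 [← hxy]
    rw [mul_assoc, mul_assoc, ← mul_assoc y, ← hn, hE.mul_eq, Nat.max_zero, hn, ← mul_assoc, hxy]

variable {M : Type*} [MonoidWithZero M]

/-- Every nonzero idempotent of a `0`-bisimple monoid is `𝒟`-equivalent to `1`. -/
theorem IsZeroBisimpleInverseOmegaSemigroup.exists_mul_eq_one
    (hM : IsZeroBisimpleInverseOmegaSemigroup M) (h1 : (1 : M) ≠ 0) {f : M}
    (hf : IsIdempotentElem f) (hf0 : f ≠ 0) :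
    ∃ p q : M, p * q = 1 ∧ q * p = f := by
  obtain ⟨z, hL, hR⟩ := (hM.greenD_iff 1 f).2 (by simp [h1, hf0])
  obtain ⟨u, hu⟩ : ∃ u, u * z = 1 := by
    rcases hL.1 with h | ⟨u, hu⟩
    · exact ⟨1, by rw [one_mul, h]⟩
    · exact ⟨u, hu⟩
  have hfz : f * z = z := by
    rcases hR.1 with rfl | ⟨w, rfl⟩
    · exact hf
    · rw [← mul_assoc, hf.eq]
  obtain ⟨t, ht⟩ : ∃ t, z * t = f := by
    rcases hR.2 with rfl | ⟨t, ht⟩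
    · exact ⟨1, mul_one _⟩
    · exact ⟨t, ht⟩
  refine ⟨u * f, z, by rw [mul_assoc, hfz, hu], ?_⟩
  have : u * f = t := by rw [← ht, ← mul_assoc, hu, one_mul]
  rw [this, ht]

/-- Conjugation by a unit is an order automorphism of the chain of idempotents, and `ℕ` has only the
trivial one. -/
theorem IsIdempotentChain.unit_commute {E : ℕ → M} (hE : IsIdempotentChain E) (u : Mˣ) (n : ℕ) :
    (u : M) * E n = E n * u := by
  have back : ∀ (v : Mˣ) (x : M), (v⁻¹ : Mˣ) * (v * x * (v⁻¹ : Mˣ)) * v = x := fun v x => by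
    rw [mul_assoc (v : M), Units.inv_mul_cancel_left, Units.inv_mul_cancel_right]
  have conj : ∀ (v : Mˣ), ∃ σ : ℕ → ℕ, ∀ n, E (σ n) = v * E n * (v⁻¹ : Mˣ) := by
    intro v
    refine Classical.skolem.1 fun n => hE.exists_eq (v * E n * (v⁻¹ : Mˣ)) ?_ ?_
    · calc (v : M) * E n * (v⁻¹ : Mˣ) * (v * E n * (v⁻¹ : Mˣ))
          = v * E n * ((v⁻¹ : Mˣ) * v) * E n * (v⁻¹ : Mˣ) := by simp only [mul_assoc]
        _ = v * (E n * E n) * (v⁻¹ : Mˣ) := by rw [Units.inv_mul, mul_one]; simp only [mul_assoc]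
        _ = _ := by rw [(hE.isIdempotentElem n).eq]
    · intro h0
      apply hE.ne_zero n
      rw [← back v (E n), h0, mul_zero, zero_mul]
  have mono : ∀ (v : Mˣ) (σ : ℕ → ℕ), (∀ n, E (σ n) = v * E n * (v⁻¹ : Mˣ)) → StrictMono σ := by
    intro v σ hσ
    refine Monotone.strictMono_of_injective (fun m n hmn => ?_) fun m n hmn => ?_
    · have : E (max (σ m) (σ n)) = E (σ n) := by
        rw [← hE.mul_eq, hσ m, hσ n]
        calc (v : M) * E m * (v⁻¹ : Mˣ) * (v * E n * (v⁻¹ : Mˣ))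
            = v * E m * ((v⁻¹ : Mˣ) * v) * E n * (v⁻¹ : Mˣ) := by simp only [mul_assoc]
          _ = v * (E m * E n) * (v⁻¹ : Mˣ) := by
              rw [Units.inv_mul, mul_one]; simp only [mul_assoc]
          _ = _ := by rw [hE.mul_eq, max_eq_right hmn]
      exact max_eq_right_iff.1 (hE.injective this)
    · apply hE.injective
      rw [← back v (E m), ← hσ, hmn, hσ, back]
  obtain ⟨σ, hσ⟩ := conj u
  obtain ⟨τ, hτ⟩ := conj u⁻¹
  have hτσ : τ (σ n) = n := by
    apply hE.injective
    rw [hτ, hσ]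
    simp [mul_assoc]
  have hn : σ n = n := le_antisymm (((mono _ _ hτ).le_apply).trans hτσ.le) (mono _ _ hσ).le_apply
  have := hσ n
  rw [hn] at this
  nth_rw 2 [this]
  rw [Units.inv_mul_cancel_right]

/-- The map `x ↦ q * x * p` shifts the chain down and reaches every idempotent below `1`, so
induction on `n` applies. -/
theorem IsIdempotentChain.exists_eq_pow_mul_pow {E : ℕ → M} (hE : IsIdempotentChain E)
    {p q : M} (hpq : p * q = 1) (hqp : q * p = E 1) (h0 : E 0 = 1) (n : ℕ) :
    ∃ k, E n = q ^ k * p ^ k := by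
  have key : ∀ x y : M, q * x * p * (q * y * p) = q * (x * y) * p := fun x y =>
    calc _ = q * x * (p * q) * y * p := by simp only [mul_assoc]
      _ = _ := by rw [hpq, mul_one]; simp only [mul_assoc]
  have back : ∀ x : M, p * (q * x * p) * q = x := fun x =>
    calc _ = p * q * x * (p * q) := by simp only [mul_assoc]
      _ = _ := by rw [hpq, mul_one, one_mul]
  have hσ : ∀ n, ∃ m, E m = q * E n * p := fun n => by
    refine hE.exists_eq _ ?_ fun hz => hE.ne_zero n ?_
    · rw [IsIdempotentElem, key, (hE.isIdempotentElem n).eq]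
    · rw [← back (E n), hz, mul_zero, zero_mul]
  choose σ hσ using hσ
  have hinj : Function.Injective σ := fun m n hmn => hE.injective <| by
    rw [← back (E m), ← hσ, hmn, hσ, back]
  have hmono : StrictMono σ := by
    refine Monotone.strictMono_of_injective (fun m n hmn => ?_) hinj
    have : E (max (σ m) (σ n)) = E (σ n) := by
      rw [← hE.mul_eq, hσ m, hσ n, key, hE.mul_eq, max_eq_right hmn]
    exact max_eq_right_iff.1 (hE.injective this)
  have hσ0 : σ 0 = 1 := hE.injective (by rw [hσ, h0, mul_one, hqp])
  have hlt : ∀ m, m < σ m := by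
    intro m
    induction m with
    | zero => omega
    | succ m ih => exact lt_of_le_of_lt ih (hmono m.lt_succ_self)
  induction n using Nat.strong_induction_on with
  | _ n ih =>
    rcases Nat.eq_zero_or_pos n with rfl | hn
    · exact ⟨0, by simp [h0]⟩
    have hqn : q * (p * E n * q) * p = E n := by
      calc _ = q * p * E n * (q * p) := by simp only [mul_assoc]
        _ = _ := by
          rw [hqp, hE.mul_eq, hE.mul_eq]
          congr 1
          omega
    obtain ⟨m, hm⟩ : ∃ m, E m = p * E n * q := by
      refine hE.exists_eq _ ?_ fun hz => hE.ne_zero n ?_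
      · calc p * E n * q * (p * E n * q) = p * (E n * (q * p) * E n) * q := by
              simp only [mul_assoc]
          _ = _ := by
            rw [hqp, hE.mul_eq, hE.mul_eq]
            congr 3
            omega
      · rw [← hqn, hz, mul_zero, zero_mul]
    have hσm : σ m = n := hE.injective (by rw [hσ, hm, hqn])
    obtain ⟨k, hk⟩ := ih m (hσm ▸ hlt m)
    refine ⟨k + 1, ?_⟩
    rw [← hσm, hσ, hk, pow_succ' q, pow_succ p]
    simp only [mul_assoc]

theorem IsZeroBisimpleInverseOmegaSemigroup.exists_isReillyFrame
    (hM : IsZeroBisimpleInverseOmegaSemigroup M) {E : ℕ → M} (hE : IsIdempotentChain E)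
    (h0 : E 0 = 1) : ∃ (p q : M) (θ : Mˣ →* Mˣ), IsReillyFrame p q θ := by
  have h10 : (1 : M) ≠ 0 := h0 ▸ hE.ne_zero 0
  obtain ⟨p, q, hpq, hqp⟩ := hM.exists_mul_eq_one h10 (hE.isIdempotentElem 1) (hE.ne_zero 1)
  -- This commutation is what makes `u ↦ p * u * q` multiplicative.
  have hcomm : ∀ u : Mˣ, q * p * u = u * (q * p) := fun u => by rw [hqp, hE.unit_commute]
  have key : ∀ u v : Mˣ, p * u * q * (p * v * q) = p * (u * v : Mˣ) * q := fun u v =>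
    calc p * u * q * (p * v * q) = p * u * (q * p * v) * q := by simp only [mul_assoc]
      _ = p * (u * v : Mˣ) * q * (p * q) := by
          rw [hcomm, Units.val_mul]; simp only [mul_assoc]
      _ = _ := by rw [hpq, mul_one]
  have hone : p * ((1 : Mˣ) : M) * q = 1 := by simp [hpq]
  let θ : Mˣ →* Mˣ := MonoidHom.mk' (fun u =>
    ⟨p * u * q, p * (u⁻¹ : Mˣ) * q, by rw [key, mul_inv_cancel, hone],
      by rw [key, inv_mul_cancel, hone]⟩) fun u v => Units.ext (key u v).symm
  have hθ : ∀ u, (θ u : M) = p * u * q := fun u => rfl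
  have hpow : ∀ n, p ^ n * q ^ n = 1 := fun n => by
    induction n with
    | zero => simp
    | succ n ih =>
      calc p ^ (n + 1) * q ^ (n + 1) = p ^ n * (p * q) * q ^ n := by
            rw [pow_succ, pow_succ']; simp only [mul_assoc]
        _ = 1 := by rw [hpq, mul_one, ih]
  refine ⟨p, q, θ, h10, hpq, ?_, fun u => ?_, fun u => ?_, fun x hx => ?_⟩
  · rw [hqp, ← h0]
    exact fun h => one_ne_zero (hE.injective h)
  · rw [hθ]
    calc p * u = p * q * p * u := by rw [hpq, one_mul]
      _ = p * (q * p * u) := by simp only [mul_assoc]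
      _ = _ := by rw [hcomm]; simp only [mul_assoc]
  · rw [hθ]
    calc u * q = u * (q * (p * q)) := by rw [hpq, mul_one]
      _ = u * (q * p) * q := by simp only [mul_assoc]
      _ = _ := by rw [← hcomm]; simp only [mul_assoc]
  · obtain ⟨y, ⟨hxy, hyx⟩, -⟩ := hM.inverse x
    obtain ⟨m, hm⟩ := hE.exists_eq (x * y) (by rw [IsIdempotentElem, ← mul_assoc, hxy])
      (fun h0 => hx (by rw [← hxy, h0, zero_mul]))
    obtain ⟨n, hn⟩ := hE.exists_eq (y * x) (by rw [IsIdempotentElem, ← mul_assoc, hyx])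
      (fun h0 => hx (by rw [← hxy, mul_assoc, h0, mul_zero]))
    obtain ⟨i, hi⟩ := hE.exists_eq_pow_mul_pow hpq hqp h0 m
    obtain ⟨j, hj⟩ := hE.exists_eq_pow_mul_pow hpq hqp h0 n
    have exy : x * y = q ^ i * p ^ i := hm.symm.trans hi
    have eyx : y * x = q ^ j * p ^ j := hn.symm.trans hj
    -- The unit is `x` stripped of its outer powers; its inverse is built likewise from the inverse
    -- `y` of `x`.
    refine ⟨i, ⟨p ^ i * x * q ^ j, p ^ j * y * q ^ i, ?_, ?_⟩, j, ?_⟩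
    · calc p ^ i * x * q ^ j * (p ^ j * y * q ^ i)
          = p ^ i * (x * (q ^ j * p ^ j) * y) * q ^ i := by simp only [mul_assoc]
        _ = p ^ i * q ^ i * (p ^ i * q ^ i) := by
            rw [← eyx, ← mul_assoc x, hxy, exy]; simp only [mul_assoc]
        _ = 1 := by rw [hpow, mul_one]
    · calc p ^ j * y * q ^ i * (p ^ i * x * q ^ j)
          = p ^ j * (y * (q ^ i * p ^ i) * x) * q ^ j := by simp only [mul_assoc]
        _ = p ^ j * q ^ j * (p ^ j * q ^ j) := by
            rw [← exy, ← mul_assoc y, hyx, eyx]; simp only [mul_assoc]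
        _ = 1 := by rw [hpow, mul_one]
    · calc x = x * y * x * (y * x) := by rw [← mul_assoc, hxy, hxy]
        _ = q ^ i * p ^ i * x * (q ^ j * p ^ j) := by rw [exy, eyx]
        _ = _ := by simp only [mul_assoc]

end Existence

/-! ### Maximal subgroups. -/

section MaximalSubgroup

/-- All elements invertible relative to `e` form a subgroup containing `G`, so maximality forces
equality. -/
theorem IsMaximalSubgroup.mem_of_mul_eq {S : Type*} [Semigroup S] {G : Subsemigroup S}
    (hG : IsMaximalSubgroup G) {e x y : S} (he : e ∈ G)
    (hid : ∀ x ∈ G, e * x = x ∧ x * e = x) (hx : e * x = x ∧ x * e = x)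
    (hy : e * y = y ∧ y * e = y) (hxy : x * y = e) (hyx : y * x = e) : x ∈ G := by
  let H : Subsemigroup S :=
    { carrier := {x | (e * x = x ∧ x * e = x) ∧
        ∃ y, (e * y = y ∧ y * e = y) ∧ x * y = e ∧ y * x = e}
      mul_mem' := by
        rintro a b ⟨ha, a', ha', haa', ha'a⟩ ⟨hb, b', hb', hbb', hb'b⟩
        refine ⟨⟨by rw [← mul_assoc, ha.1], by rw [mul_assoc, hb.2]⟩, b' * a',
          ⟨by rw [← mul_assoc, hb'.1], by rw [mul_assoc, ha'.2]⟩, ?_, ?_⟩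
        · rw [mul_assoc, ← mul_assoc b, hbb', ha'.1, haa']
        · rw [mul_assoc, ← mul_assoc a', ha'a, hb.1, hb'b] }
  have hee := (hid e he).1
  have hH : IsSubgroupOfSemigroup H := by
    refine ⟨e, ⟨⟨hee, hee⟩, e, ⟨hee, hee⟩, hee, hee⟩, fun x hx => hx.1, ?_⟩
    rintro a ⟨ha, a', ha', haa', ha'a⟩
    exact ⟨a', ⟨ha', a, ha, ha'a, haa'⟩, haa', ha'a⟩
  have hGH : G ≤ H := by
    obtain ⟨f, hf, hfid, hinv⟩ := hG.prop
    obtain rfl : f = e := by rw [← (hid f hf).1, (hfid e he).2]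
    intro a ha
    obtain ⟨b, hb, hab, hba⟩ := hinv a ha
    exact ⟨hid a ha, b, hid b hb, hab, hba⟩
  exact hG.le_of_ge hH hGH ⟨hx, y, hy, hxy, hyx⟩

end MaximalSubgroup

/-! ### Comparison with the Reilly semigroup. -/

section Isomorphism

variable {M : Type*} [MonoidWithZero M] {p q : M} {θ : Mˣ →* Mˣ} {G : Type*} [Group G]

/-- The comparison map from the Reilly semigroup of an endomorphism that corresponds to `θ`. -/
def reillyMap (p q : M) (φ : G ≃* Mˣ) (ψ : G →* G) : ReillyZero ψ → M
  | none => 0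
  | some r => q ^ r.fst * (φ r.val : M) * p ^ r.snd

theorem reillyMap_of (φ : G ≃* Mˣ) (ψ : G →* G) (i j : ℕ) (g : G) :
    reillyMap p q φ ψ (ReillyZero.of ψ i g j) = q ^ i * (φ g : M) * p ^ j := rfl

theorem ReillyZero.eq_zero_or_of {ψ : G →* G} (x : ReillyZero ψ) :
    x = 0 ∨ ∃ i g j, x = ReillyZero.of ψ i g j :=
  match x with
  | none => .inl rfl
  | some r => .inr ⟨r.fst, r.val, r.snd, rfl⟩

namespace IsReillyFrame

theorem reillyMap_mul (h : IsReillyFrame p q θ) {φ : G ≃* Mˣ} {ψ : G →* G}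
    (hψ : ∀ g, φ (ψ g) = θ (φ g)) (x y : ReillyZero ψ) :
    reillyMap p q φ ψ (x * y) = reillyMap p q φ ψ x * reillyMap p q φ ψ y := by
  rcases x.eq_zero_or_of with rfl | ⟨i, s, j, rfl⟩
  · rw [zero_mul]
    exact (zero_mul _).symm
  rcases y.eq_zero_or_of with rfl | ⟨m, t, n, rfl⟩
  · rw [mul_zero]
    exact (mul_zero _).symm
  have hit : ∀ k g, φ (ψ^[k] g) = θ^[k] (φ g) := fun k g =>
    (Function.Semiconj.iterate_right (f := φ) hψ k) g
  rw [reillyMap_of, reillyMap_of, h.mul_eq, ← hit, ← hit, ← map_mul]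
  rfl

theorem reillyMap_bijective (h : IsReillyFrame p q θ) (φ : G ≃* Mˣ) (ψ : G →* G) :
    Function.Bijective (reillyMap p q φ ψ) := by
  constructor
  · intro x y hxy
    rcases x.eq_zero_or_of with rfl | ⟨i, s, j, rfl⟩ <;>
      rcases y.eq_zero_or_of with rfl | ⟨m, t, n, rfl⟩
    · rfl
    · exact absurd hxy.symm (h.ne_zero _ _ _)
    · exact absurd hxy (h.ne_zero _ _ _)
    · rw [reillyMap_of, reillyMap_of, h.ext_iff, φ.injective.eq_iff] at hxy
      obtain ⟨rfl, rfl, rfl⟩ := hxy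
      rfl
  · intro x
    by_cases hx : x = 0
    · exact ⟨0, hx.symm⟩
    · obtain ⟨i, u, j, rfl⟩ := h.exists_eq x hx
      exact ⟨ReillyZero.of ψ i (φ.symm u) j, by rw [reillyMap_of, φ.apply_symm_apply]⟩

theorem nonempty_continuousMulEquiv [TopologicalSpace M] [T2Space M] [LocallyCompactSpace M]
    [ContinuousMul M] [TopologicalSpace G] [CompactSpace G] (h : IsReillyFrame p q θ)
    (hc : IsCompact (cell p q 0 0)) {φ : G ≃* Mˣ} (hφ : Continuous fun g => (φ g : M))
    {ψ : G →* G} (hψ : ∀ g, φ (ψ g) = θ (φ g)) : Nonempty (M ≃ₜ* ReillyZero ψ) := by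
  have hcont : ∀ i j, Continuous fun g : G => q ^ i * (φ g : M) * p ^ j := fun i j => by fun_prop
  have hopen : ∀ i j, IsOpenMap fun g : G => q ^ i * (φ g : M) * p ^ j := by
    intro i j
    -- A continuous injection from a compact space to a Hausdorff one is a closed embedding; its
    -- image is an open cell.
    have hemb := (hcont i j).isClosedEmbedding fun s t hst => φ.injective (h.ext_iff.1 hst).2.1
    refine (Topology.IsOpenEmbedding.mk hemb.isEmbedding ?_).isOpenMap
    have : (Set.range fun g : G => q ^ i * (φ g : M) * p ^ j) = cell p q i j :=
      φ.surjective.range_comp fun u : Mˣ => q ^ i * (u : M) * p ^ j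
    rw [this]
    exact h.isOpen_cell hc i j
  let e : ReillyZero ψ ≃ M := Equiv.ofBijective _ (h.reillyMap_bijective φ ψ)
  have he : Continuous e := ⟨fun V hV i j => hV.preimage (hcont i j)⟩
  have he' : IsOpenMap e := by
    intro V hV
    rw [isOpen_iff_mem_nhds]
    rintro _ ⟨x, hx, rfl⟩
    rcases x.eq_zero_or_of with rfl | ⟨i, g, j, rfl⟩
    · refine Filter.mem_of_superset ((h.isOpen_singleton_zero hc).mem_nhds rfl) ?_
      rintro _ rfl
      exact ⟨0, hx, rfl⟩
    · refine Filter.mem_of_superset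
        ((hopen i j _ (hV i j)).mem_nhds (Set.mem_image_of_mem _ hx)) ?_
      rintro _ ⟨s, hs, rfl⟩
      exact ⟨_, hs, rfl⟩
  let f : ReillyZero ψ ≃ₜ* M :=
    { e with
      map_mul' := h.reillyMap_mul hψ
      continuous_toFun := he
      continuous_invFun := (e.toHomeomorphOfContinuousOpen he he').symm.continuous }
  exact ⟨f.symm⟩

end IsReillyFrame

end Isomorphism

/-! ### From the group of units to an arbitrary maximal subgroup. -/

theorem IsZeroBisimpleInverseOmegaSemigroup.topological_structure_of_monoid {M : Type*}
    [MonoidWithZero M] [TopologicalSpace M] [T2Space M] [LocallyCompactSpace M] [ContinuousMul M]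
    (hM : IsZeroBisimpleInverseOmegaSemigroup M) {E : ℕ → M} (hE : IsIdempotentChain E)
    (hE0 : E 0 = 1) (G : Subsemigroup M) (hG : IsMaximalSubgroup G)
    (hG0 : (G : Set M) ≠ {0}) (hGc : IsCompact (G : Set M)) :
    (letI : Group G := hG.prop.group
     ∃ θ : G →* G, Continuous θ ∧ Nonempty (M ≃ₜ* ReillyZero θ)) ∧
      IsOpen ({0} : Set M) ∧ IsTopologicalSumOfHClasses M := by
  let _ : Group G := hG.prop.group
  obtain ⟨p, q, θ, h⟩ := hM.exists_isReillyFrame hE hE0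
  have hid : ∀ g : G, ((1 : G) : M) * g = g ∧ (g : M) * (1 : G) = g := fun g =>
    ⟨congrArg Subtype.val (one_mul g), congrArg Subtype.val (mul_one g)⟩
  set f : M := ((1 : G) : M) with hf
  have hff : IsIdempotentElem f := (hid 1).1
  -- This excludes the maximal subgroup `{0}`.
  have hf0 : f ≠ 0 := by
    intro h0
    refine hG0 (Set.eq_singleton_iff_unique_mem.2 ⟨h0 ▸ (1 : G).2, fun x hx => ?_⟩)
    have := (hid ⟨x, hx⟩).1
    rwa [h0, zero_mul, eq_comm] at this
  obtain ⟨c, d, hcd, hdc⟩ := hM.exists_mul_eq_one h.one_ne_zero hff hf0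
  have hmul : ∀ s t : G, c * s * d * (c * t * d) = c * (s * t : G) * d := fun s t =>
    calc c * s * d * (c * t * d) = c * s * (d * c * t) * d := by simp only [mul_assoc]
      _ = c * (s * t : M) * d := by rw [hdc, (hid t).1]; simp only [mul_assoc]
  have hone : c * ((1 : G) : M) * d = 1 := by
    rw [← hf, ← hdc, ← mul_assoc, hcd, one_mul, hcd]
  have hmem : ∀ u : Mˣ, d * u * c ∈ G := by
    have hfd : f * d = d := by rw [← hdc, mul_assoc, hcd, mul_one]
    have hcf : c * f = c := by rw [← hdc, ← mul_assoc, hcd, one_mul]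
    have hcomp : ∀ u : Mˣ, f * (d * u * c) = d * u * c ∧ d * u * c * f = d * u * c := fun u =>
      ⟨by rw [← mul_assoc, ← mul_assoc, hfd], by rw [mul_assoc, hcf]⟩
    have hinv : ∀ u : Mˣ, d * u * c * (d * (u⁻¹ : Mˣ) * c) = f := fun u =>
      calc d * u * c * (d * (u⁻¹ : Mˣ) * c) = d * (u * (c * d) * (u⁻¹ : Mˣ)) * c := by
            simp only [mul_assoc]
        _ = f := by rw [hcd, mul_one, Units.mul_inv, mul_one, hdc]
    intro u
    refine hG.mem_of_mul_eq (1 : G).2 (fun x hx => hid ⟨x, hx⟩) (hcomp u) (hcomp u⁻¹) (hinv u) ?_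
    simpa using hinv u⁻¹
  -- Since `c * d = 1` and `d * c = f`, the maps `g ↦ c * g * d` and `u ↦ d * u * c` are mutually
  -- inverse.
  let φ : G ≃* Mˣ :=
    { toFun := fun g => ⟨c * g * d, c * (g⁻¹ : G) * d, by rw [hmul, mul_inv_cancel, hone],
        by rw [hmul, inv_mul_cancel, hone]⟩
      invFun := fun u => ⟨d * u * c, hmem u⟩
      left_inv := fun g => Subtype.ext <|
        calc d * (c * g * d) * c = d * c * g * (d * c) := by simp only [mul_assoc]
          _ = g := by rw [hdc, (hid g).1, (hid g).2]
      right_inv := fun u => Units.ext <|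
        calc c * (d * u * c) * d = c * d * u * (c * d) := by simp only [mul_assoc]
          _ = u := by rw [hcd, one_mul, mul_one]
      map_mul' := fun s t => Units.ext (hmul s t).symm }
  have hφ : Continuous fun g => (φ g : M) :=
    (continuous_const.mul continuous_subtype_val).mul continuous_const
  have : CompactSpace G := isCompact_iff_compactSpace.1 hGc
  have hc : IsCompact (IsReillyFrame.cell p q 0 0) := by
    have : IsReillyFrame.cell p q 0 0 = Set.range fun g : G => (φ g : M) := by
      rw [IsReillyFrame.cell, ← φ.surjective.range_comp]
      simp [Function.comp_def]
    rw [this]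
    exact isCompact_range hφ
  have hθ : ∀ u : Mˣ, (θ u : M) = p * u * q := fun u => by
    rw [h.mul_unit, mul_assoc, h.mul_eq_one, mul_one]
  let ψ : G →* G := φ.symm.toMonoidHom.comp (θ.comp φ.toMonoidHom)
  have hψ : Continuous ψ := by
    refine Continuous.subtype_mk (f := fun g : G => d * (θ (φ g) : M) * c) ?_ _
    simp only [hθ]
    fun_prop
  exact ⟨⟨ψ, hψ, h.nonempty_continuousMulEquiv hc hφ fun g => φ.apply_symm_apply _⟩,
    h.isOpen_singleton_zero hc, h.isTopologicalSumOfHClasses hc⟩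

theorem corollary3p14 {S : Type*} [SemigroupWithZero S] [TopologicalSpace S] [T2Space S]
    [LocallyCompactSpace S] [ContinuousMul S] (hS : IsZeroBisimpleInverseOmegaSemigroup S)
    (G : Subsemigroup S) (hG : IsMaximalSubgroup G) (hG0 : (G : Set S) ≠ {0})
    (hGc : IsCompact (G : Set S)) :
    (letI : Group G := hG.prop.group
     ∃ θ : G →* G, Continuous θ ∧ Nonempty (S ≃ₜ* ReillyZero θ)) ∧
      IsOpen ({0} : Set S) ∧ IsTopologicalSumOfHClasses S := by

  obtain ⟨E, hE⟩ := hS.exists_isIdempotentChain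
  -- The largest idempotent becomes `1`; the multiplication is unchanged.
  let _ : MonoidWithZero S :=
    { ‹SemigroupWithZero S› with
      one := E 0
      one_mul := fun x => (hE.zero_mul_and_mul_zero hS x).1
      mul_one := fun x => (hE.zero_mul_and_mul_zero hS x).2 }
  exact hS.topological_structure_of_monoid hE rfl G hG hG0 hGc
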